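/- Let $d\ge 1$, let $\Omega\subset\mathbb{R}^d$ be a bounded open set, and write $\Omega^c=\mathbb{R}^d\setminus\Omega$ and $Q_\Omega=(\mathbb{R}^d\times\mathbb{R}^d)\setminus(\Omega^c\times\Omega^c)$. For a measurable function $w:\mathbb{R}^d\to\mathbb{R}$ put $$\alpha(w)=\lim_{s\to0^+}s\int_{\{|y|\ge 1\}}\frac{w(y)}{|y|^{d+2s}}\,dy$$ whenever the integrals converge absolutely for all small $s>0$ and the limit exists and is finite. Let $\mathcal{A}(\Omega)$ be the set of all $v\in L^\infty(\Omega^c)$ such that $\alpha(v^+)$, $\alpha(v^-)$ and $\alpha(v^2)$ exist, where $v^\pm=\max\{\pm v,0\}$ and these functions are extended by $0$ to $\Omega$. Fix $v\in\mathcal{A}(\Omega)$, let $L^2_{loc}(Q_\Omega,v)$ be the set of all $u\in L^2_{loc}(\mathbb{R}^d)$ with $u=v$ almost everywhere on $\Omega^c$, and for $s\in(0,1)$ define $$F_s(u)=\frac{s}{2}\iint_{Q_\Omega}\frac{|u(x)-u(y)|^2}{|x-y|^{d+2s}}\,dx\,dy\in[0,\infty]\quad\text{if }u\in L^2_{loc}(Q_\Omega,v),\qquad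 F_s(u)=+\infty\quad\text{otherwise}.$$ (i) Let $(u_s)_{s\in(0,1)}\subset L^2_{loc}(Q_\Omega,v)$ satisfy $\sup_{s\in(0,1)}F_s(u_s)<\infty$. Then for every sequence $(s_n)$ in $(0,1)$, in particular for every sequence $s_n\to0^+$, there are a subsequence $(s_{n_k})$ and a function $u\in L^2(\Omega)$ such that $u_{s_{n_k}}\rightharpoonup u$ weakly in $L^2(\Omega)$ as $k\to\infty$. (ii) That is, the functionals $F_s$, $s\in(0,1)$, are equi-coercive in the weak topology of $L^2(\Omega)$: for every $t\in[0,\infty)$ there is a weakly compact set $K\subset L^2(\Omega)$ such that, whenever $s\in(0,1)$ and $F_s(u)\le t$, the restriction of $u$ to $\Omega$ lies in $K$. -/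

import Mathlib

open Set Filter Topology MeasureTheory
open scoped NNReal ENNReal

noncomputable section

namespace MassAtInfinity

/-- `u` has finite `p`-mass at infinity equal to `a`: for all small `s > 0` the function
`u(y) / |y|^(d + s p)` is integrable outside the open unit ball centred at the origin, and
`s` times its integral there tends to `a` as `s → 0⁺`. -/
def HasMass {d : ℕ} (p : ℕ) (u : EuclideanSpace ℝ (Fin d) → ℝ) (a : ℝ) : Prop :=
  (∀ᶠ s : ℝ in 𝓝[>] 0,
    IntegrableOn (fun y => u y / ‖y‖ ^ ((d : ℝ) + s * p)) (Metric.ball 0 1)ᶜ) ∧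
  Tendsto (fun s : ℝ => s * ∫ y in (Metric.ball 0 1)ᶜ, u y / ‖y‖ ^ ((d : ℝ) + s * p))
    (𝓝[>] 0) (𝓝 a)

/-- The admissible boundary data `𝒜(Ω)`: functions in `L^∞(Ωᶜ)` such that `v⁺`, `v⁻` and `v²`
(extended by zero to `Ω`) have a finite `2`-mass at infinity. Only the values of `v` on `Ωᶜ`
matter. -/
def Admissible {d : ℕ} (Ω : Set (EuclideanSpace ℝ (Fin d))) :
    Set (EuclideanSpace ℝ (Fin d) → ℝ) :=
  {v | MemLp v ⊤ (volume.restrict Ωᶜ) ∧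
    (∃ a, HasMass 2 (Ωᶜ.indicator fun y => max (v y) 0) a) ∧
    (∃ a, HasMass 2 (Ωᶜ.indicator fun y => max (-v y) 0) a) ∧
    (∃ a, HasMass 2 (Ωᶜ.indicator fun y => v y ^ 2) a)}

/-- The functions in `L²_loc(ℝᵈ)` that agree with `v` almost everywhere on `Ωᶜ`. -/
def L2locWithDatum {d : ℕ} (Ω : Set (EuclideanSpace ℝ (Fin d)))
    (v : EuclideanSpace ℝ (Fin d) → ℝ) : Set (EuclideanSpace ℝ (Fin d) → ℝ) :=
  {u | (∀ K : Set (EuclideanSpace ℝ (Fin d)), IsCompact K → MemLp u 2 (volume.restrict K)) ∧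
    u =ᵐ[volume.restrict Ωᶜ] v}

/-- The region `Q_Ω = (ℝᵈ × ℝᵈ) \ (Ωᶜ × Ωᶜ)`. -/
def crossRegion {d : ℕ} (Ω : Set (EuclideanSpace ℝ (Fin d))) :
    Set (EuclideanSpace ℝ (Fin d) × EuclideanSpace ℝ (Fin d)) :=
  (Ωᶜ ×ˢ Ωᶜ)ᶜ

/-- The squared Gagliardo seminorm `[u]²_{H^s(Q_Ω)}`, with values in `[0, ∞]`. -/
def gagliardoSq {d : ℕ} (Ω : Set (EuclideanSpace ℝ (Fin d))) (s : ℝ)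
    (u : EuclideanSpace ℝ (Fin d) → ℝ) : ℝ≥0∞ :=
  ∫⁻ z in crossRegion Ω,
    ENNReal.ofReal (|u z.1 - u z.2| ^ 2 / ‖z.1 - z.2‖ ^ ((d : ℝ) + 2 * s))

open Classical in
/-- The functional `F_s(·, Ω)` with exterior datum `v`. -/
def energy {d : ℕ} (Ω : Set (EuclideanSpace ℝ (Fin d))) (v : EuclideanSpace ℝ (Fin d) → ℝ)
    (s : ℝ) (u : EuclideanSpace ℝ (Fin d) → ℝ) : ℝ≥0∞ :=
  if u ∈ L2locWithDatum Ω v then ENNReal.ofReal (s / 2) * gagliardoSq Ω s u else ⊤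

/-- The class in `L²(Ω)`, with its weak topology, of a function that is square integrable
on `Ω`. -/
def weakL2 {d : ℕ} {Ω : Set (EuclideanSpace ℝ (Fin d))} {u : EuclideanSpace ℝ (Fin d) → ℝ}
    (h : MemLp u 2 (volume.restrict Ω)) : WeakSpace ℝ (Lp ℝ 2 (volume.restrict Ω)) :=
  toWeakSpace ℝ (Lp ℝ 2 (volume.restrict Ω)) (h.toLp u)

end MassAtInfinity

end

/-! The exterior datum controls `u` inside `Ω`. Take a ball of radius `R` containing `Ω`. For `x` in
`Ω` and `y` outside the ball, `|x - y| ≤ 2|y|`, and `u y = v y` is bounded, so `F_s(u)` dominates a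
multiple of `∫_Ω u²` times `s ∫_{|y|>R} |y|^(-d-2s) dy`, up to a bounded error. The tail integral is
of order `1/s`, and the factor `s` cancels this exactly, so the estimate is uniform in `s ∈ (0, 1)`.
The pieces are `lintegral_compl_closedBall_norm_rpow` and `lintegral_sq_mul_tail_le`, combined in
`exists_norm_toLp_le_of_energy_le`. Banach–Alaoglu, moved to the weak topology by Riesz, then gives
both claims. -/

section L2Bound

open Metric Module

/-- The Riesz identification of the weak dual of a real Hilbert space with the space itself in its
weak topology. -/
noncomputable def weakDualToWeakSpace (H : Type*) [NormedAddCommGroup H] [InnerProductSpace ℝ H]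
    [CompleteSpace H] (f : WeakDual ℝ H) : WeakSpace ℝ H :=
  toWeakSpace ℝ H ((InnerProductSpace.toDual ℝ H).symm (WeakDual.toStrongDual f))

/-! ### Weak compactness of balls in Hilbert space. -/

section Hilbert

variable (H : Type*) [NormedAddCommGroup H] [InnerProductSpace ℝ H] [CompleteSpace H]

/-- By symmetry of the inner product, testing the representative of `f` against `g` equals
evaluating `f` at the representative of `g`, which is weak-* continuous. -/
theorem continuous_weakDualToWeakSpace : Continuous (weakDualToWeakSpace H) := by
  refine WeakBilin.continuous_of_continuous_eval _ fun g => ?_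
  have key : ∀ f : WeakDual ℝ H,
      g ((InnerProductSpace.toDual ℝ H).symm (WeakDual.toStrongDual f))
        = f ((InnerProductSpace.toDual ℝ H).symm g) := by
    intro f
    rw [← InnerProductSpace.toDual_symm_apply (y := g), real_inner_comm,
      InnerProductSpace.toDual_symm_apply]
    rfl
  exact (WeakDual.eval_continuous ((InnerProductSpace.toDual ℝ H).symm g)).congr
    fun f => (key f).symm

theorem image_weakDualToWeakSpace_closedBall (r : ℝ) :
    weakDualToWeakSpace H '' (WeakDual.toStrongDual ⁻¹' closedBall (0 : StrongDual ℝ H) r) =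
      toWeakSpace ℝ H '' closedBall (0 : H) r := by
  ext x
  constructor
  · rintro ⟨f, hf, rfl⟩
    refine ⟨_, ?_, rfl⟩
    simpa using hf
  · rintro ⟨y, hy, rfl⟩
    refine ⟨StrongDual.toWeakDual (InnerProductSpace.toDual ℝ H y), ?_, ?_⟩
    · simpa using hy
    · simp [weakDualToWeakSpace]

/-- Closed balls of a real Hilbert space are weakly compact. -/
theorem isCompact_toWeakSpace_closedBall (r : ℝ) :
    IsCompact (toWeakSpace ℝ H '' closedBall (0 : H) r) := by
  rw [← image_weakDualToWeakSpace_closedBall]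
  exact (WeakDual.isCompact_closedBall (𝕜 := ℝ) (0 : StrongDual ℝ H) r).image
    (continuous_weakDualToWeakSpace H)

/-- Closed balls of a separable real Hilbert space are weakly sequentially compact. -/
theorem isSeqCompact_toWeakSpace_closedBall [TopologicalSpace.SeparableSpace H] (r : ℝ) :
    IsSeqCompact (toWeakSpace ℝ H '' closedBall (0 : H) r) := by
  rw [← image_weakDualToWeakSpace_closedBall]
  exact (WeakDual.isSeqCompact_closedBall ℝ H (0 : StrongDual ℝ H) r).image
    (continuous_weakDualToWeakSpace H).seqContinuous

end Hilbert

/-! ### The tail of the kernel at infinity. -/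

section Tail

variable {E : Type*} [NormedAddCommGroup E] [NormedSpace ℝ E] [FiniteDimensional ℝ E]
  [Nontrivial E] [MeasurableSpace E] [BorelSpace E] (μ : Measure E) [μ.IsAddHaarMeasure]

/-- The integral of `‖y‖ ^ (-(dim E + 2 s))` outside a ball, in polar coordinates. -/
theorem lintegral_compl_closedBall_norm_rpow {R s : ℝ} (hR : 0 < R) (hs : 0 < s) :
    ∫⁻ y in (closedBall (0 : E) R)ᶜ, ENNReal.ofReal (‖y‖ ^ (-((finrank ℝ E : ℝ) + 2 * s))) ∂μ =
      ENNReal.ofReal (finrank ℝ E * μ.real (ball 0 1) * (R ^ (-(2 * s)) / (2 * s))) := by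
  set n := finrank ℝ E with hn
  have hn1 : 1 ≤ n := finrank_pos
  set f : ℝ → ℝ := (Ioi R).indicator fun r => r ^ (-((n : ℝ) + 2 * s)) with hf
  -- The polar Jacobian `r ^ (n - 1)` cancels the dimension in the exponent.
  have hradial : ∀ r ∈ Ioi (0 : ℝ),
      r ^ (n - 1) • f r = (Ioi R).indicator (fun r => r ^ (-1 - 2 * s)) r := by
    intro r hr
    by_cases h : r ∈ Ioi R
    · simp only [hf, indicator_of_mem h, smul_eq_mul]
      rw [← Real.rpow_natCast, ← Real.rpow_add hr]
      congr 1
      push_cast [Nat.cast_sub hn1]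
      ring
    · simp [hf, indicator_of_notMem h]
  have hind : (fun y : E => f ‖y‖) =
      (closedBall (0 : E) R)ᶜ.indicator fun y => ‖y‖ ^ (-((n : ℝ) + 2 * s)) := by
    ext y
    simp [hf, indicator, mem_closedBall]
  have hexp : -1 - 2 * s < -1 := by linarith
  have hint : Integrable (fun y : E => f ‖y‖) μ := by
    rw [integrable_fun_norm_addHaar, integrableOn_congr_fun hradial measurableSet_Ioi]
    exact ((integrable_indicator_iff measurableSet_Ioi).2
      (integrableOn_Ioi_rpow_of_lt hexp hR)).integrableOn
  have hval := integral_fun_norm_addHaar μ f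
  rw [setIntegral_congr_fun measurableSet_Ioi hradial, setIntegral_indicator measurableSet_Ioi,
    inter_eq_right.2 (Ioi_subset_Ioi hR.le), integral_Ioi_rpow_of_lt hexp hR] at hval
  rw [hind] at hint hval
  rw [integral_indicator measurableSet_closedBall.compl] at hval
  rw [integrable_indicator_iff measurableSet_closedBall.compl] at hint
  rw [← ofReal_integral_eq_lintegral_ofReal hint (ae_of_all _ fun y => by positivity), hval]
  congr 1
  rw [nsmul_eq_mul, smul_eq_mul, ← mul_assoc]
  congr 1
  rw [show -1 - 2 * s + 1 = -(2 * s) by ring, neg_div_neg_eq]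

end Tail

/-! ### The uniform `L²(Ω)` bound. -/

namespace MassAtInfinity

variable {d : ℕ} {Ω : Set (EuclideanSpace ℝ (Fin d))} {v u : EuclideanSpace ℝ (Fin d) → ℝ}

theorem memLp_of_mem_L2locWithDatum (hΩb : Bornology.IsBounded Ω) (hu : u ∈ L2locWithDatum Ω v) :
    MemLp u 2 (volume.restrict Ω) :=
  (hu.1 _ hΩb.isCompact_closure).mono_measure (Measure.restrict_mono subset_closure le_rfl)

/-- The kernel `‖x - y‖ ^ (-(d + 2 s))` dominates a multiple of `‖y‖ ^ (-(d + 2 s))`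
for `‖x‖ < ‖y‖`. -/
theorem norm_rpow_neg_le_inv_norm_sub_rpow {x y : EuclideanSpace ℝ (Fin d)} (hxy : ‖x‖ < ‖y‖)
    {s : ℝ} (hs : s ∈ Ioo (0 : ℝ) 1) :
    2 ^ (-((d : ℝ) + 2)) * ‖y‖ ^ (-((d : ℝ) + 2 * s)) ≤ (‖x - y‖ ^ ((d : ℝ) + 2 * s))⁻¹ := by
  have hy : 0 < ‖y‖ := (norm_nonneg x).trans_lt hxy
  have hpos : 0 < ‖x - y‖ := norm_pos_iff.2 (sub_ne_zero.2 fun h => hxy.ne (h ▸ rfl))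
  have hle : ‖x - y‖ ≤ 2 * ‖y‖ := (norm_sub_le x y).trans (by linarith)
  have he : 0 ≤ (d : ℝ) + 2 * s := by have := hs.1; positivity
  rw [Real.rpow_neg two_pos.le, Real.rpow_neg hy.le, ← mul_inv]
  refine inv_anti₀ (Real.rpow_pos_of_pos hpos _) ?_
  calc ‖x - y‖ ^ ((d : ℝ) + 2 * s) ≤ (2 * ‖y‖) ^ ((d : ℝ) + 2 * s) :=
        Real.rpow_le_rpow hpos.le hle he
    _ = 2 ^ ((d : ℝ) + 2 * s) * ‖y‖ ^ ((d : ℝ) + 2 * s) := Real.mul_rpow two_pos.le hy.le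
    -- Since `s < 1`, replacing `2 s` by `2` in the power of two makes the constant independent of
    -- `s`.
    _ ≤ _ := by
        gcongr
        · norm_num
        · linarith [hs.2]

theorem sq_mul_le_of_abs_le {a b M w N : ℝ} (hb : |b| ≤ M) (hw : 0 ≤ w) (hwN : w ≤ N⁻¹) :
    a ^ 2 * w ≤ 2 * (|a - b| ^ 2 / N) + 2 * M ^ 2 * w := by
  have h1 : a ^ 2 ≤ 2 * |a - b| ^ 2 + 2 * M ^ 2 := by
    have : b ^ 2 ≤ M ^ 2 := sq_le_sq' (abs_le.1 hb).1 (abs_le.1 hb).2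
    rw [sq_abs]
    -- `2 (a - b)² + 2 b² - a² = (a - 2 b)²`.
    nlinarith [sq_nonneg (a - 2 * b)]
  calc a ^ 2 * w ≤ (2 * |a - b| ^ 2 + 2 * M ^ 2) * w := by gcongr
    _ = 2 * (|a - b| ^ 2 * w) + 2 * M ^ 2 * w := by ring
    _ ≤ 2 * (|a - b| ^ 2 / N) + 2 * M ^ 2 * w := by
        rw [div_eq_mul_inv]
        gcongr

/-- An `L²(Ω)` bound in terms of the Gagliardo seminorm and a bound on the exterior datum. -/
theorem lintegral_sq_mul_tail_le {R M s : ℝ} (hs : s ∈ Ioo (0 : ℝ) 1) (hΩo : IsOpen Ω)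
    (hΩb : Bornology.IsBounded Ω) (hR : Ω ⊆ closedBall 0 R)
    (hM : ∀ᵐ y ∂volume.restrict Ωᶜ, |v y| ≤ M) (hu : u ∈ L2locWithDatum Ω v) :
    (∫⁻ x in Ω, ENNReal.ofReal (u x ^ 2)) *
        ∫⁻ y in (closedBall (0 : EuclideanSpace ℝ (Fin d)) R)ᶜ,
          ENNReal.ofReal (2 ^ (-((d : ℝ) + 2)) * ‖y‖ ^ (-((d : ℝ) + 2 * s))) ≤
      2 * gagliardoSq Ω s u + ENNReal.ofReal (2 * M ^ 2) * volume Ω *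
        ∫⁻ y in (closedBall (0 : EuclideanSpace ℝ (Fin d)) R)ᶜ,
          ENNReal.ofReal (2 ^ (-((d : ℝ) + 2)) * ‖y‖ ^ (-((d : ℝ) + 2 * s))) := by
  set T := (closedBall (0 : EuclideanSpace ℝ (Fin d)) R)ᶜ with hT
  set w : EuclideanSpace ℝ (Fin d) → ℝ :=
    fun y => 2 ^ (-((d : ℝ) + 2)) * ‖y‖ ^ (-((d : ℝ) + 2 * s)) with hw
  have hw0 : ∀ y, 0 ≤ w y := fun y => by positivity
  have hwm : Measurable fun y => ENNReal.ofReal (w y) := by fun_prop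
  have hum : AEMeasurable (fun x => ENNReal.ofReal (u x ^ 2)) (volume.restrict Ω) :=
    ((memLp_of_mem_L2locWithDatum hΩb hu).aestronglyMeasurable.aemeasurable.pow_const
      2).ennreal_ofReal
  have hTΩ : T ⊆ Ωᶜ := compl_subset_compl.2 hR
  have hbound : ∀ᵐ y ∂volume.restrict T, |u y| ≤ M := by
    refine ae_restrict_of_ae_restrict_of_subset hTΩ ?_
    filter_upwards [hM, hu.2] with y h1 h2
    rwa [h2]
  have hae : ∀ᵐ z ∂((volume.restrict Ω).prod (volume.restrict T)),
      ENNReal.ofReal (u z.1 ^ 2) * ENNReal.ofReal (w z.2) ≤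
        2 * ENNReal.ofReal (|u z.1 - u z.2| ^ 2 / ‖z.1 - z.2‖ ^ ((d : ℝ) + 2 * s)) +
          ENNReal.ofReal (2 * M ^ 2) * ENNReal.ofReal (w z.2) := by
    have h1 := (Measure.quasiMeasurePreserving_fst (μ := volume.restrict Ω)
      (ν := volume.restrict T)).ae
      (ae_restrict_mem hΩo.measurableSet)
    have h2 := (Measure.quasiMeasurePreserving_snd (μ := volume.restrict Ω)
      (ν := volume.restrict T)).ae
      ((ae_restrict_mem (measurableSet_closedBall.compl : MeasurableSet T)).and hbound)
    filter_upwards [h1, h2] with z hz1 hz2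
    have hlt : ‖z.1‖ < ‖z.2‖ := by
      have h3 := mem_closedBall_zero_iff.1 (hR hz1)
      have h4 : R < ‖z.2‖ := by simpa [hT] using hz2.1
      exact h3.trans_lt h4
    have htwo : ∀ a : ℝ, 2 * ENNReal.ofReal a = ENNReal.ofReal (2 * a) := fun a => by
      rw [ENNReal.ofReal_mul two_pos.le, ENNReal.ofReal_ofNat]
    rw [← ENNReal.ofReal_mul (sq_nonneg _), ← ENNReal.ofReal_mul (by positivity),
      htwo, ← ENNReal.ofReal_add (by positivity) (mul_nonneg (by positivity) (hw0 _))]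
    exact ENNReal.ofReal_le_ofReal (sq_mul_le_of_abs_le hz2.2 (hw0 _)
      (norm_rpow_neg_le_inv_norm_sub_rpow hlt hs))
  have hsub : Ω ×ˢ T ⊆ crossRegion Ω := fun z hz h => h.1 hz.1
  calc _ = ∫⁻ z, ENNReal.ofReal (u z.1 ^ 2) * ENNReal.ofReal (w z.2)
            ∂((volume.restrict Ω).prod (volume.restrict T)) :=
        (lintegral_prod_mul hum hwm.aemeasurable).symm
    _ ≤ _ := lintegral_mono_ae hae
    _ = 2 * (∫⁻ z, ENNReal.ofReal (|u z.1 - u z.2| ^ 2 / ‖z.1 - z.2‖ ^ ((d : ℝ) + 2 * s))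
            ∂((volume.restrict Ω).prod (volume.restrict T))) +
          ENNReal.ofReal (2 * M ^ 2) * volume Ω * ∫⁻ y in T, ENNReal.ofReal (w y) := by
        rw [lintegral_add_right _ (by fun_prop), lintegral_const_mul' _ _ (by norm_num),
          lintegral_prod_mul (f := fun _ => ENNReal.ofReal (2 * M ^ 2)) aemeasurable_const
            hwm.aemeasurable]
        simp
    _ ≤ _ := by
        rw [Measure.prod_restrict]
        gcongr
        exact lintegral_mono_set hsub

/-- Functions of bounded energy are bounded in `L²(Ω)`, uniformly in the order `s ∈ (0, 1)`. -/
theorem exists_norm_toLp_le_of_energy_le (hd : 1 ≤ d) (hΩo : IsOpen Ω)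
    (hΩb : Bornology.IsBounded Ω) (hv : v ∈ Admissible Ω) (t : ℝ≥0) :
    ∃ C : ℝ, ∀ s ∈ Ioo (0 : ℝ) 1, ∀ w : EuclideanSpace ℝ (Fin d) → ℝ, energy Ω v s w ≤ t →
      ∃ h : MemLp w 2 (volume.restrict Ω), ‖h.toLp w‖ ≤ C := by
  have : Nonempty (Fin d) := ⟨⟨0, hd⟩⟩
  obtain ⟨R₀, hR₀⟩ := hΩb.subset_closedBall 0
  -- `R ≥ 1` places `R ^ (-2 s)` between `R ^ (-2)` and `1` for all `s ∈ (0, 1)`.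
  set R := max R₀ 1 with hRdef
  have hR1 : 1 ≤ R := le_max_right _ _
  have hR : Ω ⊆ closedBall 0 R := hR₀.trans (closedBall_subset_closedBall (le_max_left _ _))
  obtain ⟨M, hM⟩ : ∃ M : ℝ, ∀ᵐ y ∂volume.restrict Ωᶜ, |v y| ≤ M := by
    have hfin := hv.1.eLpNorm_lt_top
    rw [eLpNorm_exponent_top] at hfin
    refine ⟨(eLpNormEssSup v (volume.restrict Ωᶜ)).toReal, ?_⟩
    filter_upwards [ae_le_eLpNormEssSup (f := v) (μ := volume.restrict Ωᶜ)] with y hy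
    have := ENNReal.toReal_mono hfin.ne hy
    simpa using this
  set κ : ℝ := 2 ^ (-((d : ℝ) + 2)) *
    (d * volume.real (ball (0 : EuclideanSpace ℝ (Fin d)) 1) / 2) with hκ
  have hκ0 : 0 < κ := by
    have : 0 < volume.real (ball (0 : EuclideanSpace ℝ (Fin d)) 1) :=
      ENNReal.toReal_pos (measure_ball_pos _ _ one_pos).ne' measure_ball_lt_top.ne
    have hd' : (0 : ℝ) < d := by exact_mod_cast hd
    positivity
  have htail : ∀ s ∈ Ioo (0 : ℝ) 1, ENNReal.ofReal s *
      ∫⁻ y in (closedBall (0 : EuclideanSpace ℝ (Fin d)) R)ᶜ,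
        ENNReal.ofReal (2 ^ (-((d : ℝ) + 2)) * ‖y‖ ^ (-((d : ℝ) + 2 * s))) =
      ENNReal.ofReal (κ * R ^ (-(2 * s))) := by
    intro s hs
    have := lintegral_compl_closedBall_norm_rpow
      (volume : Measure (EuclideanSpace ℝ (Fin d))) (zero_lt_one.trans_le hR1) hs.1
    rw [finrank_euclideanSpace_fin] at this
    simp_rw [ENNReal.ofReal_mul (show (0 : ℝ) ≤ 2 ^ (-((d : ℝ) + 2)) by positivity)]
    rw [lintegral_const_mul' _ _ ENNReal.ofReal_ne_top, this, ← ENNReal.ofReal_mul (by positivity),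
      ← ENNReal.ofReal_mul hs.1.le]
    congr 1
    rw [hκ]
    have := hs.1.ne'
    field_simp
  -- The `4` arises as `2 s = 4 (s / 2)`, the energy having prefactor `s / 2`.
  set B : ℝ≥0∞ := (4 * t + ENNReal.ofReal (2 * M ^ 2) * volume Ω * ENNReal.ofReal κ) /
    ENNReal.ofReal (κ * R ^ (-2 : ℝ)) with hB
  have hden : 0 < κ * R ^ (-2 : ℝ) := by positivity
  have hBtop : B ≠ ⊤ := by
    refine ENNReal.div_ne_top (ENNReal.add_ne_top.2 ⟨?_, ?_⟩) (by simpa using hden)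
    · exact ENNReal.mul_ne_top (by norm_num) ENNReal.coe_ne_top
    · exact ENNReal.mul_ne_top (ENNReal.mul_ne_top ENNReal.ofReal_ne_top hΩb.measure_lt_top.ne)
        ENNReal.ofReal_ne_top
  refine ⟨(B ^ (1 / 2 : ℝ)).toReal, fun s hs w hw => ?_⟩
  have hmem : w ∈ L2locWithDatum Ω v := by
    by_contra hcon
    simp [energy, hcon] at hw
  have h := memLp_of_mem_L2locWithDatum hΩb hmem
  refine ⟨h, ?_⟩
  rw [energy, if_pos hmem] at hw
  have hG : ENNReal.ofReal s * (2 * gagliardoSq Ω s w) ≤ 4 * t := by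
    calc ENNReal.ofReal s * (2 * gagliardoSq Ω s w)
        = 4 * (ENNReal.ofReal (s / 2) * gagliardoSq Ω s w) := by
          rw [← mul_assoc, ← mul_assoc, ← ENNReal.ofReal_ofNat 2, ← ENNReal.ofReal_ofNat 4,
            ← ENNReal.ofReal_mul hs.1.le, ← ENNReal.ofReal_mul (by norm_num)]
          congr 2
          ring
      _ ≤ 4 * t := by gcongr
  have hlow : κ * R ^ (-2 : ℝ) ≤ κ * R ^ (-(2 * s)) := by
    have := hs.2
    gcongr
    linarith
  have hup : κ * R ^ (-(2 * s)) ≤ κ :=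
    mul_le_of_le_one_right hκ0.le
      (Real.rpow_le_one_of_one_le_of_nonpos hR1 (by have := hs.1; linarith))
  have hsq : ∫⁻ x in Ω, ENNReal.ofReal (w x ^ 2) ≤ B := by
    rw [hB, ENNReal.le_div_iff_mul_le (Or.inl (by simpa using hden))
      (Or.inl ENNReal.ofReal_ne_top)]
    calc (∫⁻ x in Ω, ENNReal.ofReal (w x ^ 2)) * ENNReal.ofReal (κ * R ^ (-2 : ℝ))
        ≤ (∫⁻ x in Ω, ENNReal.ofReal (w x ^ 2)) * ENNReal.ofReal (κ * R ^ (-(2 * s))) := by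
          gcongr
      _ = ENNReal.ofReal s * ((∫⁻ x in Ω, ENNReal.ofReal (w x ^ 2)) *
            ∫⁻ y in (closedBall (0 : EuclideanSpace ℝ (Fin d)) R)ᶜ,
              ENNReal.ofReal (2 ^ (-((d : ℝ) + 2)) * ‖y‖ ^ (-((d : ℝ) + 2 * s)))) := by
          rw [← htail s hs]; ring
      _ ≤ _ := mul_le_mul_right (lintegral_sq_mul_tail_le hs hΩo hΩb hR hM hmem) _
      _ = ENNReal.ofReal s * (2 * gagliardoSq Ω s w) +
            ENNReal.ofReal (2 * M ^ 2) * volume Ω * ENNReal.ofReal (κ * R ^ (-(2 * s))) := by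
          rw [← htail s hs]; ring
      _ ≤ 4 * t + ENNReal.ofReal (2 * M ^ 2) * volume Ω * ENNReal.ofReal κ := by
          gcongr
  rw [Lp.norm_toLp]
  refine ENNReal.toReal_mono (ENNReal.rpow_ne_top_of_nonneg (by norm_num) hBtop) ?_
  rw [eLpNorm_eq_lintegral_rpow_enorm_toReal (by norm_num) (by norm_num)]
  simp only [ENNReal.toReal_ofNat, ENNReal.rpow_ofNat]
  gcongr
  refine (lintegral_mono fun x => ?_).trans hsq
  rw [← sq_abs, ENNReal.ofReal_pow (abs_nonneg _), ← Real.norm_eq_abs, ofReal_norm]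

end MassAtInfinity

end L2Bound

theorem mainTheorem7 {d : ℕ} (hd : 1 ≤ d) (Ω : Set (EuclideanSpace ℝ (Fin d)))
    (hΩo : IsOpen Ω) (hΩb : Bornology.IsBounded Ω)
    (v : EuclideanSpace ℝ (Fin d) → ℝ) (hv : v ∈ MassAtInfinity.Admissible Ω) :
    -- compactness of families with bounded energy
    (∀ u : ℝ → EuclideanSpace ℝ (Fin d) → ℝ,
      (∀ s ∈ Ioo (0 : ℝ) 1, u s ∈ MassAtInfinity.L2locWithDatum Ω v) →
      (⨆ s ∈ Ioo (0 : ℝ) 1, MassAtInfinity.energy Ω v s (u s)) < ⊤ →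
      ∀ σ : ℕ → ℝ, (∀ n, σ n ∈ Ioo (0 : ℝ) 1) →
        ∃ φ : ℕ → ℕ, StrictMono φ ∧
          ∃ h : ∀ n, MemLp (u (σ (φ n))) 2 (volume.restrict Ω),
            ∃ u₀ : EuclideanSpace ℝ (Fin d) → ℝ, ∃ h₀ : MemLp u₀ 2 (volume.restrict Ω),
              Tendsto (fun n => MassAtInfinity.weakL2 (h n)) atTop
                (𝓝 (MassAtInfinity.weakL2 h₀))) ∧
    -- equi-coercivity in the weak topology of `L²(Ω)`
    (∀ t : ℝ≥0, ∃ K : Set (WeakSpace ℝ (Lp ℝ 2 (volume.restrict Ω))), IsCompact K ∧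
      ∀ s ∈ Ioo (0 : ℝ) 1, ∀ w : EuclideanSpace ℝ (Fin d) → ℝ,
        MassAtInfinity.energy Ω v s w ≤ t →
          ∃ h : MemLp w 2 (volume.restrict Ω), MassAtInfinity.weakL2 h ∈ K) := by
  -- Instance needed for separability of `L²(Ω)`, hence for sequential compactness.
  have : Fact ((2 : ℝ≥0∞) ≠ ⊤) := ⟨ENNReal.ofNat_ne_top⟩
  have hbd := MassAtInfinity.exists_norm_toLp_le_of_energy_le hd hΩo hΩb hv
  refine ⟨fun u hu hE σ hσ => ?_, fun t => ?_⟩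
  · obtain ⟨C, hC⟩ := hbd (⨆ s ∈ Ioo (0 : ℝ) 1, MassAtInfinity.energy Ω v s (u s)).toNNReal
    have hle : ∀ s ∈ Ioo (0 : ℝ) 1, MassAtInfinity.energy Ω v s (u s) ≤
        ((⨆ s ∈ Ioo (0 : ℝ) 1, MassAtInfinity.energy Ω v s (u s)).toNNReal : ℝ≥0∞) := by
      intro s hs
      rw [ENNReal.coe_toNNReal hE.ne]
      exact le_iSup₂ (f := fun s _ => MassAtInfinity.energy Ω v s (u s)) s hs
    choose h hn using fun n => hC (σ n) (hσ n) (u (σ n)) (hle _ (hσ n))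
    obtain ⟨a, ⟨b, -, rfl⟩, φ, hφ, hlim⟩ := isSeqCompact_toWeakSpace_closedBall
      (Lp ℝ 2 (volume.restrict Ω)) C
      (x := fun n => MassAtInfinity.weakL2 (h n))
      fun n => ⟨(h n).toLp _, by simpa only [Metric.mem_closedBall, dist_zero_right] using hn n, rfl⟩
    refine ⟨φ, hφ, fun n => h (φ n), b, Lp.memLp b, ?_⟩
    rw [MassAtInfinity.weakL2, Lp.toLp_coeFn]
    exact hlim
  · obtain ⟨C, hC⟩ := hbd t
    refine ⟨_, isCompact_toWeakSpace_closedBall (Lp ℝ 2 (volume.restrict Ω)) C,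
      fun s hs w hw => ?_⟩
    obtain ⟨h, hn⟩ := hC s hs w hw
    exact ⟨h, h.toLp w, by simpa only [Metric.mem_closedBall, dist_zero_right] using hn, rfl⟩
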